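/- Let $W$ be a discrete memoryless channel with finite input alphabet $\mathcal X$, finite output alphabet $\mathcal Y$ and capacity $C=\max_{P_X} I(X;Y)>0$, and let $K\ge 1$ be fixed. All logarithms are to base $2$. *Codes and errors.* A $K$-MOID code of length $n$ for $N$ receivers consists of an encoder $\varphi:\mathcal Z\times\mathcal V\to\mathcal X^n$, where $\mathcal Z$ is the set of all $K$-element subsets of $\mathcal N=\{1,\dots,N\}$, and decoders $\psi_i:\mathcal Y^n\to\{\mathrm T,\mathrm F\}$, $i\in\mathcal N$. Its rate is $R^{(n)}=\frac1n\log\log N$. With $V$ uniform on $\mathcal V$ and $\varphi(\mathcal K,V)$ sent over $W$, $\lambda_1^{(n)}$ is the maximum over $\mathcal K\in\mathcal Z$ and $i\in\mathcal K$ of the probability that $\psi_i$ outputs $\mathrm F$, and $\lambda_2^{(n)}$ is the maximum over $\mathcal K\in\mathcal Z$ and $i\notin\mathcal K$ of the probability that $\psi_i$ outputs $\mathrm T$. *Coding Scheme 1.* Let $q=2^m$, $m\ge1$, $k\ge1$, $t=k-1$, and let $\{h_v\}_{v\in\mathcal V}$ be an $\varepsilon$-almost strongly universal class of hash functions $h_v:\mathcal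 N\to\mathcal B$ with $N=q^{kq^{t}}$, $\mathcal B=\mathrm{GF}(q)$, $|\mathcal V|=q^{k+2}$ and $\varepsilon=\frac kq+\frac{q^t-1}{q^k}$; that is, $|\{v:h_v(\alpha)=\beta\}|=|\mathcal V|/|\mathcal B|$ for all $\alpha,\beta$, and $|\{v:h_v(\alpha_1)=\beta_1,\,h_v(\alpha_2)=\beta_2\}|\le\varepsilon|\mathcal V|/|\mathcal B|$ for all $\alpha_1\ne\alpha_2$ and all $\beta_1,\beta_2$. Let $f:\mathcal V\times\mathcal B^K\to\mathcal X^n$ and $g:\mathcal Y^n\to\mathcal V\times\mathcal B^K$ be the encoder and decoder of a transmission code. The $K$-MOID code is given by $\varphi(\{i_1<\dots<i_K\},v)=f(v,h_v(i_1),\dots,h_v(i_K))$, and by $\psi_i(y^n)=\mathrm T$ if and only if $h_{\hat v}(i)=\beta_j$ for some $1\le j\le K$, where $(\hat v,\beta_1,\dots,\beta_K)=g(y^n)$. Then the $K$-MOID codes constructed by Coding Scheme 1 can achieve $$\lim_{n\to\infty}R^{(n)}=C,\qquad \lim_{n\to\infty}\lambda_1^{(n)}=0,\qquad \lim_{n\to\infty}\lambda_2^{(n)}=0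 .$$ More precisely, there are parameters $k_n,m_n\ge 1$ and transmission codes $(f_n,g_n)$ of length $n$, for all $n$, such that hash classes with the parameters $(k_n,m_n)$ exist and the three limits hold whichever such classes are used. -/

import Mathlib

open Filter Topology

noncomputable section

/-- A discrete memoryless channel with finite output alphabet `Y`: `prob x y` is the transition
probability `W(y | x)`. -/
structure DMC (X Y : Type*) [Fintype Y] where
  prob : X → Y → ℝ
  prob_nonneg : ∀ x y, 0 ≤ prob x y
  sum_prob : ∀ x, ∑ y, prob x y = 1

namespace DMC

variable {X Y : Type*} [Fintype Y]

/-- The `n`-fold memoryless extension `Wⁿ(yⁿ | xⁿ) = ∏ₜ W(yₜ | xₜ)`. -/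
def blockProb (W : DMC X Y) {n : ℕ} (x : Fin n → X) (y : Fin n → Y) : ℝ :=
  ∏ t, W.prob (x t) (y t)

/-- The mutual information `I(X; Y)` in bits, for input distribution `P`. Summands with
`P x * W(y | x) = 0` vanish; in all the others the quotient is positive. -/
def mutualInfo [Fintype X] (W : DMC X Y) (P : X → ℝ) : ℝ :=
  ∑ x, ∑ y, P x * W.prob x y *
    Real.logb 2 (W.prob x y / ∑ x', P x' * W.prob x' y)

/-- The capacity `C = max_P I(X; Y)`, over all probability distributions `P` on `X`. -/
def capacity [Fintype X] (W : DMC X Y) : ℝ :=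
  sSup (W.mutualInfo '' stdSimplex ℝ X)

end DMC

/-- The possible sets of `K` selected receivers among `N`. -/
abbrev Selection (N K : ℕ) : Type :=
  {S : Finset (Fin N) // S.card = K}

/-- A `K`-MOID code for `N` receivers with code length `n`, whose encoder uses a random number
in `V`. The decoder output `true` stands for `T`, `false` for `F`. -/
structure MOIDCode (X Y V : Type*) (N K n : ℕ) where
  enc : Selection N K → V → (Fin n → X)
  dec : Fin N → (Fin n → Y) → Bool

namespace MOIDCode

variable {X Y V : Type*} [Fintype Y] [Fintype V] {N K n : ℕ}

/-- The probability that receiver `i` outputs `u` when `S` is encoded, the random number is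
uniform on `V`, and the codeword is sent through `W`. -/
def outputProb (c : MOIDCode X Y V N K n) (W : DMC X Y) (S : Selection N K) (i : Fin N)
    (u : Bool) : ℝ :=
  (∑ v : V, ∑ y : Fin n → Y, if c.dec i y = u then W.blockProb (c.enc S v) y else 0) /
    (Fintype.card V : ℝ)

/-- Type I decoding error probability: worst case of a selected receiver deciding `F`. -/
def typeIError (c : MOIDCode X Y V N K n) (W : DMC X Y) : ℝ :=
  ⨆ S : Selection N K, ⨆ i : {i : Fin N // i ∈ S.1}, c.outputProb W S i.1 false

/-- Type II decoding error probability: worst case of an unselected receiver deciding `T`. -/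
def typeIIError (c : MOIDCode X Y V N K n) (W : DMC X Y) : ℝ :=
  ⨆ S : Selection N K, ⨆ i : {i : Fin N // i ∉ S.1}, c.outputProb W S i.1 true

/-- The coding rate `(1/n) log log N`, with logarithms to base 2. -/
def rate (_c : MOIDCode X Y V N K n) : ℝ :=
  Real.logb 2 (Real.logb 2 N) / n

end MOIDCode

/-- The class `{h v : v ∈ V}` of hash functions `A → B` is `ε`-almost strongly universal.
The class is indexed by `V` and counted with multiplicity. -/
def IsASU {V A B : Type*} (ε : ℝ) (h : V → A → B) : Prop :=
  (∀ (a : A) (b : B),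
    ({v : V | h v a = b}.ncard : ℝ) = (Nat.card V : ℝ) / (Nat.card B : ℝ)) ∧
  ∀ (a₁ a₂ : A), a₁ ≠ a₂ → ∀ b₁ b₂ : B,
    ({v : V | h v a₁ = b₁ ∧ h v a₂ = b₂}.ncard : ℝ) ≤
      ε * ((Nat.card V : ℝ) / (Nat.card B : ℝ))

/-- An `ε`-almost strongly universal class with the Kurosawa-Yoshida parameters:
for `q = 2 ^ m`, it consists of `q ^ (k + 2)` functions from a set of `N = q ^ (k * q ^ t)`
elements to `GF(q)`, and `ε = k / q + (q ^ t - 1) / q ^ k`. -/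
def IsKYClass (m k t : ℕ)
    (h : Fin ((2 ^ m) ^ (k + 2)) → Fin ((2 ^ m) ^ (k * (2 ^ m) ^ t)) → GaloisField 2 m) : Prop :=
  IsASU ((k : ℝ) / 2 ^ m + (((2 : ℝ) ^ m) ^ t - 1) / ((2 : ℝ) ^ m) ^ k) h

open Classical in
/-- The `K`-MOID code built from a class of hash functions `h` and a transmission code `(f, g)`.
For `S = {i₁ < ⋯ < i_K}`, the encoder sends `f (v, h_v(i₁), …, h_v(i_K))`. Receiver `i` computes
`g(yⁿ) = (v', b₁, …, b_K)` and outputs `T` if and only if `h_{v'}(i) = b_j` for some `j`. -/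
def codingScheme1 {X Y V B : Type*} {N K n : ℕ} (h : V → Fin N → B)
    (f : V × (Fin K → B) → (Fin n → X)) (g : (Fin n → Y) → V × (Fin K → B)) :
    MOIDCode X Y V N K n where
  enc S v := f (v, fun j => h v (S.1.orderEmbOfFin S.2 j))
  dec i y := decide (∃ j : Fin K, h (g y).1 i = (g y).2 j)

end

/-!
An unselected receiver outputs `T` only if the transmission fails or its hash collides with one of
the `K` transmitted hashes, so both errors are small once the transmission code is reliable and the
hash class has a small `ε`, while a selected receiver errs only if the transmission fails.

Reliable codes at all rates below capacity come from Feinstein's greedy construction, with a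
Chernoff bound on the information density. The hash classes are Stinson's composition of polynomial
evaluation over a field with `q ^ k` elements (a Reed–Solomon code) with a strongly universal
polynomial hash over `GF(q)`. As `q = 2 ^ m`, the message takes `m * (k + 2 + K)` bits, whereas
`log log N` is about `m * (k - 1)`, so nothing is lost asymptotically when `k → ∞`; and
`ε ≤ (k + 1) / 2 ^ m` vanishes as long as `m` grows at least linearly in `k`.
-/

theorem exists_lt_of_hasDerivAt_neg {f : ℝ → ℝ} {f' a : ℝ} (hf : HasDerivAt f f' a)
    (hf' : f' < 0) : ∃ x > a, f x < f a := by
  have hslope := (hasDerivWithinAt_iff_tendsto_slope' Set.self_notMem_Ioi).1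
    (hf.hasDerivWithinAt (s := Set.Ioi a))
  obtain ⟨x, hx, hax⟩ := ((hslope.eventually_lt_const hf').and self_mem_nhdsWithin).exists
  rw [slope_def_field, div_neg_iff] at hx
  exact ⟨x, hax, by rcases hx with hx | hx <;> linarith [hx.1, hx.2, sub_pos.2 hax]⟩

theorem exists_le_of_le_sum_mul {ι : Type*} [Fintype ι] {P u : ι → ℝ} {c : ℝ}
    (hP : P ∈ stdSimplex ℝ ι) (h : c ≤ ∑ i, P i * u i) : ∃ i, c ≤ u i := by
  have hι : Nonempty ι := by
    by_contra hι
    rw [not_nonempty_iff] at hι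
    simp [stdSimplex_of_isEmpty_index] at hP
  obtain ⟨i, hi⟩ := Finite.exists_max u
  refine ⟨i, h.trans ?_⟩
  calc ∑ j, P j * u j ≤ ∑ j, P j * u i :=
        Finset.sum_le_sum fun j _ => mul_le_mul_of_nonneg_left (hi j) (hP.1 j)
    _ = u i := by rw [← Finset.sum_mul, hP.2, one_mul]

theorem exists_tendsto_atTop_eventually {p : ℕ → ℕ → Prop} (h : ∀ j, ∀ᶠ n in atTop, p j n) :
    ∃ J : ℕ → ℕ, Tendsto J atTop atTop ∧ ∀ᶠ n in atTop, p (J n) n := by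
  classical
  refine ⟨fun n => Nat.findGreatest (p · n) n, tendsto_atTop.2 fun j => ?_, ?_⟩
  · filter_upwards [h j, eventually_ge_atTop j] with n hn hj using Nat.le_findGreatest hj hn
  · filter_upwards [h 0] with n hn using Nat.findGreatest_spec (P := (p · n)) (Nat.zero_le n) hn

/-- The distribution of `n` independent inputs with common distribution `P`. -/
noncomputable def iidDist {X : Type*} (P : X → ℝ) (n : ℕ) : (Fin n → X) → ℝ :=
  fun x => ∏ t, P (x t)

theorem iidDist_mem_stdSimplex {X : Type*} [Fintype X] {P : X → ℝ} (hP : P ∈ stdSimplex ℝ X)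
    (n : ℕ) : iidDist P n ∈ stdSimplex ℝ (Fin n → X) :=
  ⟨fun x => Finset.prod_nonneg fun t _ => hP.1 (x t), by
    simp only [iidDist, ← Fintype.prod_sum fun _ x => P x, hP.2, Finset.prod_const_one]⟩

namespace DMC

variable {X Y A : Type*} [Fintype Y]

/-- The `n`-fold memoryless extension of `W`, as a single use of a channel on blocks. -/
noncomputable def block (W : DMC X Y) (n : ℕ) : DMC (Fin n → X) (Fin n → Y) where
  prob := W.blockProb
  prob_nonneg _ _ := Finset.prod_nonneg fun _ _ => W.prob_nonneg _ _
  sum_prob x := by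
    simp only [blockProb, ← Fintype.prod_sum fun t y => W.prob (x t) y, W.sum_prob,
      Finset.prod_const_one]

theorem sum_prob_le_one (W : DMC X Y) (x : X) (s : Finset Y) : ∑ y ∈ s, W.prob x y ≤ 1 :=
  (Finset.sum_le_univ_sum_of_nonneg (W.prob_nonneg x)).trans_eq (W.sum_prob x)

open Classical in
/-- The transmission code with encoder `f` and decoder `g` has maximal error probability at most
`lam` over a single use of `W`. Codes of length `n` are codes for `W.block n`. -/
def MaxErrorLE (W : DMC X Y) (f : A → X) (g : Y → A) (lam : ℝ) : Prop :=
  ∀ a, ∑ y with g y ≠ a, W.prob (f a) y ≤ lam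

theorem MaxErrorLE.sum_le {W : DMC X Y} {f : A → X} {g : Y → A} {lam : ℝ}
    (h : W.MaxErrorLE f g lam) {a : A} {s : Finset Y} (hs : ∀ y ∈ s, g y ≠ a) :
    ∑ y ∈ s, W.prob (f a) y ≤ lam := by
  classical
  refine le_trans (Finset.sum_le_sum_of_subset_of_nonneg (fun y hy => ?_)
    fun y _ _ => W.prob_nonneg _ y) (h a)
  exact Finset.mem_filter.2 ⟨Finset.mem_univ y, hs y hy⟩

section Information

variable [Fintype X]

/-- The output distribution of `W` for the input distribution `P`. -/
def outputDist (W : DMC X Y) (P : X → ℝ) (y : Y) : ℝ :=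
  ∑ x, P x * W.prob x y

/-- The probability that the information density `log (W(y | x) / Q(y))` is at most `log γ`, where
`Q` is the output distribution. It is written without a quotient so that `Q(y) = 0` is harmless. -/
noncomputable def lowInfoProb (W : DMC X Y) (P : X → ℝ) (γ : ℝ) : ℝ :=
  ∑ x, ∑ y with W.prob x y ≤ γ * W.outputDist P y, P x * W.prob x y

/-- The moment generating function of the negative information density, `E[(Q(Y) / W(Y | X))ˢ]`
for the output distribution `Q`. -/
noncomputable def infoMGF (W : DMC X Y) (P : X → ℝ) (s : ℝ) : ℝ :=
  ∑ x, ∑ y, P x * W.prob x y * (W.outputDist P y / W.prob x y) ^ s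

variable {W : DMC X Y} {P : X → ℝ}

theorem outputDist_nonneg (hP : ∀ x, 0 ≤ P x) (y : Y) : 0 ≤ W.outputDist P y :=
  Finset.sum_nonneg fun x _ => mul_nonneg (hP x) (W.prob_nonneg x y)

theorem outputDist_pos (hP : ∀ x, 0 ≤ P x) {x : X} {y : Y} (h : P x * W.prob x y ≠ 0) :
    0 < W.outputDist P y :=
  Finset.sum_pos' (fun x _ => mul_nonneg (hP x) (W.prob_nonneg x y))
    ⟨x, Finset.mem_univ x, (mul_nonneg (hP x) (W.prob_nonneg x y)).lt_of_ne' h⟩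

omit [Fintype X] in
theorem prob_pos_of_mul_ne_zero {x : X} {y : Y} (h : P x * W.prob x y ≠ 0) : 0 < W.prob x y :=
  (W.prob_nonneg x y).lt_of_ne' (right_ne_zero_of_mul h)

theorem outputDist_div_prob_nonneg (hP : ∀ x, 0 ≤ P x) (x : X) (y : Y) :
    0 ≤ W.outputDist P y / W.prob x y :=
  div_nonneg (outputDist_nonneg hP y) (W.prob_nonneg x y)

theorem lowInfoProb_nonneg (hP : ∀ x, 0 ≤ P x) (γ : ℝ) : 0 ≤ W.lowInfoProb P γ :=
  Finset.sum_nonneg fun x _ => Finset.sum_nonneg fun y _ => mul_nonneg (hP x) (W.prob_nonneg x y)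

theorem infoMGF_zero (hP : ∑ x, P x = 1) : W.infoMGF P 0 = 1 := by
  simp [infoMGF, ← Finset.mul_sum, W.sum_prob, hP]

theorem infoMGF_nonneg (hP : ∀ x, 0 ≤ P x) (s : ℝ) : 0 ≤ W.infoMGF P s :=
  Finset.sum_nonneg fun x _ => Finset.sum_nonneg fun y _ => mul_nonneg
    (mul_nonneg (hP x) (W.prob_nonneg x y))
    (Real.rpow_nonneg (outputDist_div_prob_nonneg hP x y) s)

theorem mutualInfo_mul_log_two : W.mutualInfo P * Real.log 2 =
    -∑ x, ∑ y, P x * W.prob x y * Real.log (W.outputDist P y / W.prob x y) := by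
  have hlog : Real.log 2 ≠ 0 := (Real.log_pos one_lt_two).ne'
  simp only [mutualInfo, Real.logb, outputDist, Finset.sum_mul, ← Finset.sum_neg_distrib]
  refine Finset.sum_congr rfl fun x _ => Finset.sum_congr rfl fun y _ => ?_
  rw [← inv_div (W.prob x y), Real.log_inv]
  field_simp

theorem hasDerivAt_infoMGF (hP : ∀ x, 0 ≤ P x) :
    HasDerivAt (W.infoMGF P) (-(W.mutualInfo P * Real.log 2)) 0 := by
  rw [mutualInfo_mul_log_two, neg_neg]
  refine HasDerivAt.fun_sum fun x _ => HasDerivAt.fun_sum fun y _ => ?_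
  by_cases h : P x * W.prob x y = 0
  · simpa [h] using hasDerivAt_const (0 : ℝ) (0 : ℝ)
  · have hpos := div_pos (outputDist_pos hP h) (prob_pos_of_mul_ne_zero h)
    simpa using ((hasDerivAt_id (0 : ℝ)).const_rpow hpos).const_mul (P x * W.prob x y)

theorem exists_rpow_mul_infoMGF_lt_one (hP : P ∈ stdSimplex ℝ X) {r : ℝ}
    (hr : r < W.mutualInfo P) : ∃ s > 0, ((2 : ℝ) ^ r) ^ s * W.infoMGF P s < 1 := by
  have hpow : HasDerivAt (fun s : ℝ => ((2 : ℝ) ^ r) ^ s) (r * Real.log 2) 0 := by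
    simpa [Real.log_rpow two_pos] using
      (hasDerivAt_id (0 : ℝ)).const_rpow (Real.rpow_pos_of_pos two_pos r)
  have hderiv := hpow.fun_mul (hasDerivAt_infoMGF (W := W) hP.1)
  obtain ⟨s, hs, hlt⟩ := exists_lt_of_hasDerivAt_neg hderiv (by
    rw [infoMGF_zero hP.2, Real.rpow_zero]
    linarith [mul_lt_mul_of_pos_right hr (Real.log_pos one_lt_two)])
  exact ⟨s, hs, by simpa [infoMGF_zero hP.2] using hlt⟩

theorem lowInfoProb_le_rpow_mul_infoMGF (hP : ∀ x, 0 ≤ P x) {γ s : ℝ} (hγ : 0 ≤ γ)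
    (hs : 0 ≤ s) : W.lowInfoProb P γ ≤ γ ^ s * W.infoMGF P s := by
  simp only [lowInfoProb, infoMGF, Finset.mul_sum, Finset.sum_filter]
  refine Finset.sum_le_sum fun x _ => Finset.sum_le_sum fun y _ => ?_
  have hjoint : 0 ≤ P x * W.prob x y := mul_nonneg (hP x) (W.prob_nonneg x y)
  have hratio := outputDist_div_prob_nonneg (W := W) hP x y
  rw [mul_left_comm, ← Real.mul_rpow hγ hratio]
  split_ifs with hlow
  · by_cases h0 : P x * W.prob x y = 0
    · rw [h0, zero_mul]
    · refine le_mul_of_one_le_right hjoint (Real.one_le_rpow ?_ hs)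
      rwa [← mul_div_assoc, one_le_div (prob_pos_of_mul_ne_zero h0)]
  · exact mul_nonneg hjoint (Real.rpow_nonneg (mul_nonneg hγ hratio) s)

theorem outputDist_block (n : ℕ) (y : Fin n → Y) :
    (W.block n).outputDist (iidDist P n) y = ∏ t, W.outputDist P (y t) := by
  simp only [outputDist, iidDist, block, blockProb, ← Finset.prod_mul_distrib]
  exact (Fintype.prod_sum fun t x => P x * W.prob x (y t)).symm

theorem infoMGF_block (hP : ∀ x, 0 ≤ P x) (n : ℕ) (s : ℝ) :
    (W.block n).infoMGF (iidDist P n) s = W.infoMGF P s ^ n := by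
  have hterm (x : Fin n → X) (y : Fin n → Y) : iidDist P n x * (W.block n).prob x y *
      ((W.block n).outputDist (iidDist P n) y / (W.block n).prob x y) ^ s =
      ∏ t, P (x t) * W.prob (x t) (y t) * (W.outputDist P (y t) / W.prob (x t) (y t)) ^ s := by
    rw [outputDist_block]
    simp only [iidDist, block, blockProb]
    rw [← Finset.prod_div_distrib, ← Real.finsetProd_rpow _ _ fun t _ =>
      outputDist_div_prob_nonneg hP _ _, ← Finset.prod_mul_distrib, ← Finset.prod_mul_distrib]
  have hinner (x : Fin n → X) := Fintype.prod_sum fun t y =>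
    P (x t) * W.prob (x t) y * (W.outputDist P y / W.prob (x t) y) ^ s
  have houter := Fintype.prod_sum fun (_ : Fin n) x =>
    ∑ y, P x * W.prob x y * (W.outputDist P y / W.prob x y) ^ s
  simp only [infoMGF, hterm, ← hinner, ← houter, Finset.prod_const, Finset.card_univ,
    Fintype.card_fin]

theorem tendsto_lowInfoProb_block (hP : P ∈ stdSimplex ℝ X) {r : ℝ} (hr : r < W.mutualInfo P) :
    Tendsto (fun n => (W.block n).lowInfoProb (iidDist P n) (2 ^ (n * r))) atTop (𝓝 0) := by
  obtain ⟨s, hs, hlt⟩ := exists_rpow_mul_infoMGF_lt_one hP hr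
  have hiid (n : ℕ) := (iidDist_mem_stdSimplex hP n).1
  refine squeeze_zero (fun n => lowInfoProb_nonneg (hiid n) _) (fun n => ?_)
    (tendsto_pow_atTop_nhds_zero_of_lt_one
      (mul_nonneg (by positivity) (infoMGF_nonneg hP.1 s)) hlt)
  calc (W.block n).lowInfoProb (iidDist P n) (2 ^ (n * r))
      ≤ ((2 : ℝ) ^ (n * r)) ^ s * (W.block n).infoMGF (iidDist P n) s :=
        lowInfoProb_le_rpow_mul_infoMGF (hiid n) (by positivity) hs.le
    _ = (((2 : ℝ) ^ r) ^ s * W.infoMGF P s) ^ n := by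
        rw [infoMGF_block hP.1, mul_pow, mul_comm (n : ℝ), Real.rpow_mul two_pos.le,
          Real.rpow_pow_comm (by positivity), Real.rpow_natCast]

end Information

section Feinstein

variable [Fintype X] {W : DMC X Y} {P : X → ℝ}

open Classical in
theorem exists_one_sub_le_sum_prob (hP : P ∈ stdSimplex ℝ X) (γ : ℝ) (U : Finset Y) :
    ∃ x, 1 - (W.lowInfoProb P γ + ∑ y ∈ U, W.outputDist P y) ≤
      ∑ y with y ∉ U ∧ γ * W.outputDist P y < W.prob x y, W.prob x y := by
  refine exists_le_of_le_sum_mul hP (sub_le_iff_le_add'.2 ?_)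
  have hcover (x : X) : 1 ≤ (∑ y with W.prob x y ≤ γ * W.outputDist P y, W.prob x y) +
      ∑ y ∈ U, W.prob x y +
      ∑ y with y ∉ U ∧ γ * W.outputDist P y < W.prob x y, W.prob x y := by
    rw [← W.sum_prob x, ← Finset.filter_univ_mem U]
    simp only [Finset.sum_filter, ← Finset.sum_add_distrib, Finset.mem_filter, Finset.mem_univ,
      true_and]
    refine Finset.sum_le_sum fun y _ => ?_
    have := W.prob_nonneg x y
    grind
  calc (1 : ℝ) = ∑ x, P x * 1 := by simp only [mul_one, hP.2]
    _ ≤ ∑ x, P x * _ :=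
      Finset.sum_le_sum fun x _ => mul_le_mul_of_nonneg_left (hcover x) (hP.1 x)
    _ = _ := by
      simp only [mul_add, Finset.sum_add_distrib, lowInfoProb, outputDist, Finset.mul_sum]
      rw [Finset.sum_comm (s := U)]

open Classical in
/-- A stage of Feinstein's greedy construction: the messages in `s` have codewords `f a` and
decoding sets `{y | g y = some a}`, each of probability at least `1 - lam` and made of outputs whose
information density with the codeword exceeds `log γ`. Outputs not yet assigned to a message decode
to `none`. -/
structure IsPartialCode (W : DMC X Y) (P : X → ℝ) (γ lam : ℝ) (s : Finset A) (f : A → X)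
    (g : Y → Option A) : Prop where
  mem_of_eq_some : ∀ {y a}, g y = some a → a ∈ s
  lt_prob : ∀ {y a}, g y = some a → γ * W.outputDist P y < W.prob (f a) y
  one_sub_le : ∀ {a}, a ∈ s → 1 - lam ≤ ∑ y with g y = some a, W.prob (f a) y

namespace IsPartialCode

variable {γ lam : ℝ} {s : Finset A} {f : A → X} {g : Y → Option A}

open Classical in
theorem sum_outputDist_le (h : W.IsPartialCode P γ lam s f g) (hγ : 0 < γ) :
    ∑ y with g y ≠ none, W.outputDist P y ≤ s.card / γ := by
  have hset (a : A) : ∑ y with g y = some a, W.outputDist P y ≤ 1 / γ := by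
    rw [le_div_iff₀' hγ, Finset.mul_sum]
    calc ∑ y with g y = some a, γ * W.outputDist P y ≤ ∑ y with g y = some a, W.prob (f a) y :=
          Finset.sum_le_sum fun y hy => (h.lt_prob (Finset.mem_filter.1 hy).2).le
      _ ≤ 1 := W.sum_prob_le_one _ _
  have hunion : Finset.univ.filter (g · ≠ none) = s.biUnion fun a => {y | g y = some a} := by
    ext y
    simp only [Finset.mem_filter, Finset.mem_univ, true_and, Finset.mem_biUnion,
      Option.ne_none_iff_exists']
    exact exists_congr fun a => ⟨fun hy => ⟨h.mem_of_eq_some hy, hy⟩, And.right⟩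
  have hdisj : (s : Set A).PairwiseDisjoint fun a => ({y | g y = some a} : Finset Y) :=
    fun a _ b _ hab => Finset.disjoint_filter.2 fun y _ ha hb =>
      hab (Option.some.inj (ha.symm.trans hb))
  calc _ = ∑ a ∈ s, ∑ y with g y = some a, W.outputDist P y := by
        rw [hunion, Finset.sum_biUnion hdisj]
    _ ≤ ∑ _a ∈ s, 1 / γ := Finset.sum_le_sum fun a _ => hset a
    _ = s.card / γ := by rw [Finset.sum_const, nsmul_eq_mul, mul_one_div]

open Classical in
theorem exists_insert (h : W.IsPartialCode P γ lam s f g) (hP : P ∈ stdSimplex ℝ X) (hγ : 0 < γ)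
    (hlam : W.lowInfoProb P γ + s.card / γ ≤ lam) {a : A} (ha : a ∉ s) :
    ∃ f' g', W.IsPartialCode P γ lam (insert a s) f' g' := by
  obtain ⟨x, hx⟩ := exists_one_sub_le_sum_prob (W := W) hP γ {y | g y ≠ none}
  have hused := h.sum_outputDist_le hγ
  let f' := Function.update f a x
  let g' := fun y => if g y = none ∧ γ * W.outputDist P y < W.prob x y then some a else g y
  have hnew (y : Y) : g' y = some a ↔ g y = none ∧ γ * W.outputDist P y < W.prob x y := by
    have := fun hy : g y = some a => ha (h.mem_of_eq_some hy)
    grind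
  have hold {b : A} (hb : b ≠ a) (y : Y) : g' y = some b ↔ g y = some b := by grind
  have hf'a : f' a = x := Function.update_self a x f
  have hf' {b : A} (hb : b ≠ a) : f' b = f b := Function.update_of_ne hb x f
  refine ⟨f', g', ⟨fun {y b} hy => ?_, fun {y b} hy => ?_, fun {b} hb => ?_⟩⟩ <;>
    obtain rfl | hba := eq_or_ne b a
  · exact Finset.mem_insert_self b s
  · exact Finset.mem_insert_of_mem (h.mem_of_eq_some ((hold hba y).1 hy))
  · rw [hf'a]
    exact ((hnew y).1 hy).2
  · rw [hf' hba]
    exact h.lt_prob ((hold hba y).1 hy)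
  · simp only [hf'a, hnew]
    simp only [Finset.mem_filter, Finset.mem_univ, true_and, not_not] at hx
    linarith
  · simp only [hf' hba, hold hba]
    exact h.one_sub_le (Finset.mem_of_mem_insert_of_ne hb hba)

end IsPartialCode

theorem exists_isPartialCode (hP : P ∈ stdSimplex ℝ X) {γ lam : ℝ} (hγ : 0 < γ) (s : Finset A)
    (hlam : W.lowInfoProb P γ + s.card / γ ≤ lam) : ∃ f g, W.IsPartialCode P γ lam s f g := by
  classical
  induction s using Finset.induction_on with
  | empty =>
    obtain ⟨x, -⟩ := exists_le_of_le_sum_mul (u := 0) hP (by simp : (0 : ℝ) ≤ _)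
    exact ⟨fun _ => x, fun _ => none, by simp, by simp, by simp⟩
  | insert a s ha ih =>
    have hcard : W.lowInfoProb P γ + s.card / γ ≤ lam := by
      refine le_trans ?_ hlam
      gcongr
      exact Finset.subset_insert a s
    obtain ⟨f, g, h⟩ := ih hcard
    exact h.exists_insert hP hγ hcard ha

theorem exists_maxErrorLE [Finite A] [Nonempty A] (hP : P ∈ stdSimplex ℝ X) {γ lam : ℝ}
    (hγ : 0 < γ) (hlam : W.lowInfoProb P γ + Nat.card A / γ ≤ lam) :
    ∃ (f : A → X) (g : Y → A), W.MaxErrorLE f g lam := by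
  classical
  have := Fintype.ofFinite A
  rw [Nat.card_eq_fintype_card] at hlam
  obtain ⟨f, g, h⟩ := exists_isPartialCode hP hγ Finset.univ hlam
  refine ⟨f, fun y => (g y).getD (Classical.arbitrary A), fun a => ?_⟩
  calc ∑ y with (g y).getD _ ≠ a, W.prob (f a) y ≤ ∑ y with ¬ g y = some a, W.prob (f a) y := by
        refine Finset.sum_le_sum_of_subset_of_nonneg (Finset.monotone_filter_right _ ?_)
          fun y _ _ => W.prob_nonneg _ y
        intro y _ hy hya
        exact hy (by rw [hya, Option.getD_some])
    _ = 1 - ∑ y with g y = some a, W.prob (f a) y := by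
        rw [← W.sum_prob (f a), eq_sub_iff_add_eq', Finset.sum_filter_add_sum_filter_not]
    _ ≤ lam := sub_le_comm.1 (h.one_sub_le (Finset.mem_univ a))

end Feinstein

section Achievability

variable [Fintype X] (W : DMC X Y)

theorem nonempty_of_capacity_ne_zero {W : DMC X Y} (hC : W.capacity ≠ 0) : Nonempty X := by
  by_contra hX
  rw [not_nonempty_iff] at hX
  simp [capacity, stdSimplex_of_isEmpty_index] at hC

theorem exists_lt_mutualInfo [Nonempty X] {R : ℝ} (hR : R < W.capacity) :
    ∃ P ∈ stdSimplex ℝ X, R < W.mutualInfo P := by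
  classical
  have hne : (W.mutualInfo '' stdSimplex ℝ X).Nonempty :=
    Set.Nonempty.image _ ⟨_, single_mem_stdSimplex ℝ (Classical.arbitrary X)⟩
  obtain ⟨_, ⟨P, hP, rfl⟩, hRP⟩ := exists_lt_of_lt_csSup hne hR
  exact ⟨P, hP, hRP⟩

theorem eventually_exists_maxErrorLE [Nonempty X] {R lam : ℝ} (hR : R < W.capacity)
    (hlam : 0 < lam) : ∀ᶠ n : ℕ in atTop, ∀ (A : Type*) [Finite A] [Nonempty A],
      (Nat.card A : ℝ) ≤ 2 ^ (n * R) →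
        ∃ (f : A → Fin n → X) (g : (Fin n → Y) → A), (W.block n).MaxErrorLE f g lam := by
  obtain ⟨P, hP, hRP⟩ := W.exists_lt_mutualInfo hR
  obtain ⟨r, hRr, hr⟩ := exists_between hRP
  have hratio : Tendsto (fun n : ℕ => ((2 : ℝ) ^ (R - r)) ^ n) atTop (𝓝 0) :=
    tendsto_pow_atTop_nhds_zero_of_lt_one (by positivity)
      (Real.rpow_lt_one_of_one_lt_of_neg one_lt_two (sub_neg.2 hRr))
  have hbound := (tendsto_lowInfoProb_block hP hr).add hratio
  rw [add_zero] at hbound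
  filter_upwards [hbound.eventually_lt_const hlam] with n hn A _ _ hA
  refine exists_maxErrorLE (iidDist_mem_stdSimplex hP n) (γ := 2 ^ (n * r)) (by positivity) ?_
  calc _ ≤ (W.block n).lowInfoProb (iidDist P n) (2 ^ (n * r)) +
        2 ^ (n * R) / 2 ^ (n * r) := by gcongr
    _ = (W.block n).lowInfoProb (iidDist P n) (2 ^ (n * r)) + ((2 : ℝ) ^ (R - r)) ^ n := by
        rw [← Real.rpow_mul_natCast two_pos.le, mul_comm (R - r), mul_sub, Real.rpow_sub two_pos]
    _ ≤ lam := hn.le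

theorem exists_tendsto_zero_eventually_exists_maxErrorLE [Nonempty X] :
    ∃ d : ℕ → ℝ, (∀ n, 0 ≤ d n) ∧ Tendsto d atTop (𝓝 0) ∧
      ∀ᶠ n : ℕ in atTop, ∀ (A : Type*) [Finite A] [Nonempty A],
        (Nat.card A : ℝ) ≤ 2 ^ (n * (W.capacity - d n)) →
          ∃ (f : A → Fin n → X) (g : (Fin n → Y) → A), (W.block n).MaxErrorLE f g (d n) := by
  obtain ⟨J, hJ, hcode⟩ := exists_tendsto_atTop_eventually fun j : ℕ =>
    W.eventually_exists_maxErrorLE (R := W.capacity - 1 / (j + 1)) (lam := 1 / (j + 1))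
      (sub_lt_self _ Nat.one_div_pos_of_nat) Nat.one_div_pos_of_nat
  exact ⟨fun n => 1 / (J n + 1), fun n => Nat.one_div_pos_of_nat.le,
    tendsto_one_div_add_atTop_nhds_zero_nat.comp hJ, hcode⟩

end Achievability

end DMC

section Hashing

open Polynomial

variable {V V₁ V₂ A E B : Type*}

theorem ncard_setOf_prod [Fintype V₁] [Finite V₂] (p : V₁ × V₂ → Prop) :
    {v | p v}.ncard = ∑ v₁, {v₂ | p (v₁, v₂)}.ncard :=
  (Nat.card_congr (Equiv.subtypeProdEquivSigmaSubtype fun v₁ v₂ => p (v₁, v₂))).trans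
    Nat.card_sigma

theorem ncard_setOf_eval_eq_zero_le {R : Type*} [CommRing R] [IsDomain R] {p : R[X]}
    (hp : p ≠ 0) : {x | p.eval x = 0}.ncard ≤ p.natDegree := by
  have hroots : {x | p.eval x = 0} = p.rootSet R := by
    ext x
    simp [mem_rootSet, hp]
  exact hroots ▸ p.ncard_rootSet_le R

/-- The class `{h v : v ∈ V}` of hash functions `A → B` is `ε`-almost universal: any two distinct
arguments collide for at most a fraction `ε` of the functions. As in `IsASU`, the class is indexed
by `V` and counted with multiplicity. -/
def IsAU (ε : ℝ) (h : V → A → B) : Prop :=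
  ∀ a₁ a₂ : A, a₁ ≠ a₂ → ({v | h v a₁ = h v a₂}.ncard : ℝ) ≤ ε * Nat.card V

theorem IsASU.isAU [Finite B] {ε : ℝ} {h : V → A → B} (hh : IsASU ε h) : IsAU ε h := by
  intro a₁ a₂ ha
  have := Fintype.ofFinite B
  have hunion : {v | h v a₁ = h v a₂} = ⋃ b, {v | h v a₁ = b ∧ h v a₂ = b} := by
    ext v
    simp [eq_comm]
  obtain hB | hB := isEmpty_or_nonempty B
  · simp [hunion, @Nat.card_of_isEmpty V ⟨fun v => hB.elim (h v a₁)⟩]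
  calc ({v | h v a₁ = h v a₂}.ncard : ℝ)
      ≤ ∑ b, ({v | h v a₁ = b ∧ h v a₂ = b}.ncard : ℝ) := by
        rw [hunion]
        exact_mod_cast Set.ncard_iUnion_le_of_fintype _
    _ ≤ ∑ _b : B, ε * (Nat.card V / Nat.card B) :=
        Finset.sum_le_sum fun b _ => hh.2 a₁ a₂ ha b b
    _ = ε * Nat.card V := by
        rw [Finset.sum_const, nsmul_eq_mul, Finset.card_univ, ← Nat.card_eq_fintype_card]
        have : (Nat.card B : ℝ) ≠ 0 := Nat.cast_ne_zero.2 Nat.card_pos.ne'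
        field_simp

theorem IsASU.of_equiv {V' A' : Type*} {ε : ℝ} {h : V → A → B} (hh : IsASU ε h) (eV : V' ≃ V)
    (eA : A' ≃ A) : IsASU ε fun v a => h (eV v) (eA a) := by
  have hcard (p : V → Prop) : {v | p (eV v)}.ncard = {v | p v}.ncard :=
    Nat.card_congr (eV.subtypeEquivOfSubtype (p := p))
  rw [IsASU, Nat.card_congr eV]
  exact ⟨fun a b => (congrArg _ (hcard fun v => h v (eA a) = b)).trans (hh.1 _ _),
    fun a₁ a₂ ha b₁ b₂ => (congrArg _ (hcard fun v => h v (eA a₁) = b₁ ∧ h v (eA a₂) = b₂)).trans_le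
      (hh.2 _ _ (eA.injective.ne ha) _ _)⟩

theorem isAU_eval [Field E] [Finite E] (d : ℕ) :
    IsAU ((d - 1) / Nat.card E) fun (x : E) (p : degreeLT E d) => p.1.eval x := by
  intro p₁ p₂ hp
  have hsub : (p₁ - p₂).1 ≠ 0 := Subtype.coe_ne_coe.2 (sub_ne_zero.2 hp)
  have hdegree : (p₁ - p₂).1.natDegree < d :=
    (natDegree_lt_iff_degree_lt hsub).2 (mem_degreeLT.1 (p₁ - p₂).2)
  have hroots : {x | p₁.1.eval x = p₂.1.eval x}.ncard < d := by
    simpa [sub_eq_zero] using (ncard_setOf_eval_eq_zero_le hsub).trans_lt hdegree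
  rw [div_mul_cancel₀ _ (Nat.cast_ne_zero.2 Nat.card_pos.ne'), le_sub_iff_add_le]
  exact_mod_cast hroots

/-- Polynomial hashing with key `(a, b)`: a word, given as the polynomial `c` of degree less than
`k` with its letters as coefficients, is sent to `b + a * c(a)`. -/
noncomputable def polyHash [Field B] (k : ℕ) (v : B × B) (c : degreeLT B k) : B :=
  v.2 + v.1 * c.1.eval v.1

theorem ncard_polyHash_eq [Field B] [Finite B] {k : ℕ} (c : degreeLT B k) (b : B) :
    {v | polyHash k v c = b}.ncard = Nat.card B := by
  have := Fintype.ofFinite B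
  have hfiber (a : B) : {x | polyHash k (a, x) c = b} = {b - a * c.1.eval a} := by
    ext x
    simp [polyHash, eq_sub_iff_add_eq]
  rw [ncard_setOf_prod]
  simp only [hfiber, Set.ncard_singleton, Finset.sum_const, smul_eq_mul, mul_one,
    Finset.card_univ, Nat.card_eq_fintype_card]

theorem ncard_polyHash_eq_and_eq_le [Field B] [Finite B] {k : ℕ} {c₁ c₂ : degreeLT B k}
    (hc : c₁ ≠ c₂) (b₁ b₂ : B) :
    {v | polyHash k v c₁ = b₁ ∧ polyHash k v c₂ = b₂}.ncard ≤ k := by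
  let p : B[X] := X * (c₁ - c₂).1 - C (b₁ - b₂)
  have hsub : (c₁ - c₂).1 ≠ 0 := Subtype.coe_ne_coe.2 (sub_ne_zero.2 hc)
  have hdegree : (c₁ - c₂).1.natDegree < k :=
    (natDegree_lt_iff_degree_lt hsub).2 (mem_degreeLT.1 (c₁ - c₂).2)
  have hp : p.natDegree = (c₁ - c₂).1.natDegree + 1 := by
    rw [natDegree_sub_C, natDegree_X_mul hsub]
  have hp0 : p ≠ 0 := ne_zero_of_natDegree_gt (n := 0) (by omega)
  calc _ ≤ {a | p.eval a = 0}.ncard := by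
        refine Set.ncard_le_ncard_of_injOn Prod.fst ?_ ?_
        · rintro ⟨a, x⟩ ⟨rfl, rfl⟩
          simp [p, polyHash]
          ring
        · rintro ⟨a, x⟩ ⟨rfl, -⟩ ⟨_, x'⟩ ⟨hx, -⟩ rfl
          exact Prod.ext rfl (add_right_cancel hx).symm
    _ ≤ k := by
        have := ncard_setOf_eval_eq_zero_le hp0
        omega

theorem isASU_polyHash [Field B] [Finite B] (k : ℕ) :
    IsASU (k / Nat.card B) (polyHash (B := B) k) := by
  have hB : (Nat.card B : ℝ) ≠ 0 := Nat.cast_ne_zero.2 Nat.card_pos.ne'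
  have hkeys : (Nat.card (B × B) : ℝ) / Nat.card B = Nat.card B := by
    rw [Nat.card_prod, Nat.cast_mul, mul_div_cancel_right₀ _ hB]
  refine ⟨fun c b => ?_, fun c₁ c₂ hc b₁ b₂ => ?_⟩
  · rw [hkeys, ncard_polyHash_eq]
  · rw [hkeys, div_mul_cancel₀ _ hB]
    exact_mod_cast ncard_polyHash_eq_and_eq_le hc b₁ b₂

theorem IsAU.comp_isASU [Finite V₁] [Finite V₂] {ε₁ ε₂ : ℝ} {h₁ : V₁ → A → E} {h₂ : V₂ → E → B}
    (hh₁ : IsAU ε₁ h₁) (hh₂ : IsASU ε₂ h₂) (hε₂ : 0 ≤ ε₂) :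
    IsASU (ε₁ + ε₂) fun (v : V₁ × V₂) a => h₂ v.2 (h₁ v.1 a) := by
  classical
  have := Fintype.ofFinite V₁
  let r : ℝ := Nat.card V₂ / Nat.card B
  have hr : 0 ≤ r := by positivity
  have hkeys : (Nat.card (V₁ × V₂) : ℝ) / Nat.card B = Nat.card V₁ * r := by
    rw [Nat.card_prod, Nat.cast_mul, mul_div_assoc]
  refine ⟨fun a b => ?_, fun a₁ a₂ ha b₁ b₂ => ?_⟩
  · rw [hkeys, ncard_setOf_prod, Nat.cast_sum, Finset.sum_congr rfl fun v _ => hh₂.1 (h₁ v a) b,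
      Finset.sum_const, nsmul_eq_mul, Finset.card_univ, ← Nat.card_eq_fintype_card]
  have hfiber (v : V₁) : ({w | h₂ w (h₁ v a₁) = b₁ ∧ h₂ w (h₁ v a₂) = b₂}.ncard : ℝ) ≤
      ((if h₁ v a₁ = h₁ v a₂ then 1 else 0) + ε₂) * r := by
    rw [add_mul]
    split_ifs with hcoll
    · refine le_add_of_le_of_nonneg ?_ (mul_nonneg hε₂ hr)
      rw [one_mul, ← show _ = r from hh₂.1 (h₁ v a₁) b₁]
      exact_mod_cast Set.ncard_le_ncard fun w => And.left
    · rw [zero_mul, zero_add]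
      exact hh₂.2 _ _ hcoll b₁ b₂
  have hcoll : (∑ v, if h₁ v a₁ = h₁ v a₂ then (1 : ℝ) else 0) ≤ ε₁ * Nat.card V₁ := by
    simpa [Set.ncard_eq_toFinset_card'] using hh₁ a₁ a₂ ha
  calc _ = ∑ v, ({w | h₂ w (h₁ v a₁) = b₁ ∧ h₂ w (h₁ v a₂) = b₂}.ncard : ℝ) := by
        rw [ncard_setOf_prod, Nat.cast_sum]
    _ ≤ ∑ v, ((if h₁ v a₁ = h₁ v a₂ then 1 else 0) + ε₂) * r :=
        Finset.sum_le_sum fun v _ => hfiber v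
    _ = ((∑ v, if h₁ v a₁ = h₁ v a₂ then 1 else 0) + Nat.card V₁ * ε₂) * r := by
        rw [← Finset.sum_mul, Finset.sum_add_distrib, Finset.sum_const, nsmul_eq_mul,
          Finset.card_univ, Nat.card_eq_fintype_card]
    _ ≤ (ε₁ * Nat.card V₁ + Nat.card V₁ * ε₂) * r := by gcongr
    _ = (ε₁ + ε₂) * (Nat.card (V₁ × V₂) / Nat.card B) := by
        rw [hkeys]
        ring

theorem finite_degreeLT (R : Type*) [Semiring R] [Finite R] (d : ℕ) : Finite (degreeLT R d) :=
  .of_equiv _ (degreeLTEquiv R d).toEquiv.symm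

theorem natCard_degreeLT (R : Type*) [Semiring R] (d : ℕ) :
    Nat.card (degreeLT R d) = Nat.card R ^ d := by
  rw [Nat.card_congr (degreeLTEquiv R d).toEquiv, Nat.card_fun, Nat.card_fin]

theorem natCard_galoisField_two {m : ℕ} (hm : 1 ≤ m) : Nat.card (GaloisField 2 m) = 2 ^ m :=
  GaloisField.card 2 m (Nat.one_le_iff_ne_zero.1 hm)

theorem exists_isKYClass {m k : ℕ} (hm : 1 ≤ m) (hk : 1 ≤ k) (t : ℕ) :
    ∃ h, IsKYClass m k t h := by
  let B := GaloisField 2 m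
  let E := GaloisField 2 (m * k)
  have hB : Nat.card B = 2 ^ m := natCard_galoisField_two hm
  have hE : Nat.card E = (2 ^ m) ^ k := by
    rw [natCard_galoisField_two (Nat.mul_pos hm hk), pow_mul]
  have := finite_degreeLT B k
  have := finite_degreeLT E ((2 ^ m) ^ t)
  let eE : E ≃ degreeLT B k := (Finite.card_eq.1 (by rw [natCard_degreeLT, hB, hE])).some
  let eV : Fin ((2 ^ m) ^ (k + 2)) ≃ E × B × B :=
    (Finite.card_eq.1 (by rw [Nat.card_fin, Nat.card_prod, Nat.card_prod, hB, hE]; ring)).some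
  let eA : Fin ((2 ^ m) ^ (k * (2 ^ m) ^ t)) ≃ degreeLT E ((2 ^ m) ^ t) :=
    (Finite.card_eq.1 (by rw [Nat.card_fin, natCard_degreeLT, hE, pow_mul])).some
  have hinner : IsASU (k / Nat.card B) fun (v : B × B) x => polyHash k v (eE x) :=
    (isASU_polyHash k).of_equiv (.refl _) eE
  have hclass := ((isAU_eval ((2 ^ m) ^ t)).comp_isASU hinner (by positivity)).of_equiv eV eA
  have hε : ((((2 ^ m) ^ t : ℕ) : ℝ) - 1) / Nat.card E + k / Nat.card B =
      k / 2 ^ m + (((2 : ℝ) ^ m) ^ t - 1) / ((2 : ℝ) ^ m) ^ k := by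
    rw [hB, hE, add_comm]
    push_cast
    rfl
  rw [hε] at hclass
  exact ⟨_, hclass⟩

end Hashing

section Errors

variable {X Y V B : Type*} [Fintype Y] [Fintype V] {W : DMC X Y} {N K n : ℕ}

namespace MOIDCode

variable (c : MOIDCode X Y V N K n)

theorem outputProb_nonneg (W : DMC X Y) (S : Selection N K) (i : Fin N) (u : Bool) :
    0 ≤ c.outputProb W S i u := by
  simp only [outputProb, ← Finset.sum_filter]
  exact div_nonneg (Finset.sum_nonneg fun v _ => Finset.sum_nonneg fun y _ =>
    (W.block n).prob_nonneg _ y) (Nat.cast_nonneg _)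

theorem typeIError_nonneg (W : DMC X Y) : 0 ≤ c.typeIError W :=
  Real.iSup_nonneg fun _ => Real.iSup_nonneg fun _ => c.outputProb_nonneg W _ _ _

theorem typeIIError_nonneg (W : DMC X Y) : 0 ≤ c.typeIIError W :=
  Real.iSup_nonneg fun _ => Real.iSup_nonneg fun _ => c.outputProb_nonneg W _ _ _

theorem outputProb_le {c : MOIDCode X Y V N K n} {S : Selection N K} {i : Fin N} {u : Bool}
    {b : V → ℝ} (hb : ∀ v, ∑ y with c.dec i y = u, W.blockProb (c.enc S v) y ≤ b v) :
    c.outputProb W S i u ≤ (∑ v, b v) / Fintype.card V := by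
  simp only [outputProb, ← Finset.sum_filter]
  gcongr with v
  exact hb v

end MOIDCode

variable {lam ε : ℝ} {h : V → Fin N → B} {f : V × (Fin K → B) → Fin n → X}
  {g : (Fin n → Y) → V × (Fin K → B)}

theorem typeIError_codingScheme1_le (hlam : 0 ≤ lam) (hfg : (W.block n).MaxErrorLE f g lam) :
    (codingScheme1 h f g).typeIError W ≤ lam := by
  refine Real.iSup_le (fun S => Real.iSup_le (fun ⟨i, hi⟩ => ?_) hlam) hlam
  calc _ ≤ (∑ _v : V, lam) / Fintype.card V :=
        MOIDCode.outputProb_le fun v => hfg.sum_le fun y hy hgy => ?_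
    _ ≤ lam := by
        rw [Finset.sum_const, nsmul_eq_mul, Finset.card_univ]
        exact div_le_of_le_mul₀ (Nat.cast_nonneg _) hlam (mul_comm _ _).le
  obtain ⟨j, hj⟩ : i ∈ Set.range (S.1.orderEmbOfFin S.2) := by
    rwa [Finset.range_orderEmbOfFin]
  have hreject : ∀ j, h (g y).1 i ≠ (g y).2 j := by
    simpa only [codingScheme1, decide_eq_false_iff_not, not_exists] using (Finset.mem_filter.1 hy).2
  exact hreject j (by simp only [hgy, hj])

omit [Fintype V] in
open Classical in
theorem sum_blockProb_dec_codingScheme1_le (hlam : 0 ≤ lam) (hfg : (W.block n).MaxErrorLE f g lam)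
    (S : Selection N K) (i : Fin N) (v : V) :
    ∑ y with (codingScheme1 h f g).dec i y = true,
        W.blockProb ((codingScheme1 h f g).enc S v) y ≤
      lam + ∑ j, if h v i = h v (S.1.orderEmbOfFin S.2 j) then 1 else 0 := by
  have hterm (j : Fin K) : (0 : ℝ) ≤ if h v i = h v (S.1.orderEmbOfFin S.2 j) then 1 else 0 := by
    positivity
  by_cases hcoll : ∃ j, h v i = h v (S.1.orderEmbOfFin S.2 j)
  · obtain ⟨j, hj⟩ := hcoll
    refine ((W.block n).sum_prob_le_one _ _).trans (le_add_of_nonneg_of_le hlam ?_)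
    exact (if_pos hj).ge.trans (Finset.single_le_sum (fun j _ => hterm j) (Finset.mem_univ j))
  · refine le_add_of_le_of_nonneg (hfg.sum_le fun y hy hgy => hcoll ?_)
      (Finset.sum_nonneg fun j _ => hterm j)
    simpa [codingScheme1, hgy] using hy

theorem typeIIError_codingScheme1_le (hlam : 0 ≤ lam) (hε : 0 ≤ ε) (hh : IsAU ε h)
    (hfg : (W.block n).MaxErrorLE f g lam) :
    (codingScheme1 h f g).typeIIError W ≤ lam + K * ε := by
  classical
  have hbound : 0 ≤ lam + K * ε := by positivity
  refine Real.iSup_le (fun S => Real.iSup_le (fun ⟨i, hi⟩ => ?_) hbound) hbound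
  set e := S.1.orderEmbOfFin S.2
  have hcoll (j : Fin K) : ∑ v, (if h v i = h v (e j) then (1 : ℝ) else 0) ≤
      ε * Fintype.card V := by
    have hne : i ≠ e j := fun hij => hi (hij ▸ S.1.orderEmbOfFin_mem S.2 j)
    simpa [Set.ncard_eq_toFinset_card'] using hh i (e j) hne
  refine (MOIDCode.outputProb_le fun v =>
    sum_blockProb_dec_codingScheme1_le hlam hfg S i v).trans ?_
  refine div_le_of_le_mul₀ (Nat.cast_nonneg _) hbound ?_
  calc ∑ v, (lam + ∑ j, if h v i = h v (e j) then (1 : ℝ) else 0)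
      = Fintype.card V * lam + ∑ j, ∑ v, if h v i = h v (e j) then (1 : ℝ) else 0 := by
        rw [Finset.sum_add_distrib, Finset.sum_comm, Finset.sum_const, nsmul_eq_mul,
          Finset.card_univ]
    _ ≤ Fintype.card V * lam + ∑ _j : Fin K, ε * Fintype.card V := by
        gcongr with j
        exact hcoll j
    _ = (lam + K * ε) * Fintype.card V := by
        rw [Finset.sum_const, nsmul_eq_mul, Finset.card_univ, Fintype.card_fin]
        ring

end Errors

section Parameters

theorem logb_two_natCast_le (a : ℕ) : Real.logb 2 a ≤ a := by
  obtain rfl | ha := a.eq_zero_or_pos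
  · simp
  rw [Real.logb_le_iff_le_rpow one_lt_two (Nat.cast_pos.2 ha), Real.rpow_natCast]
  exact_mod_cast Nat.lt_two_pow_self.le

theorem tendsto_logb_two_div {a : ℕ → ℕ} (ha : Tendsto (fun n => (a n : ℝ) / n) atTop (𝓝 0)) :
    Tendsto (fun n => Real.logb 2 (a n) / n) atTop (𝓝 0) := by
  refine squeeze_zero (fun n => ?_) (fun n => ?_) ha
  · exact div_nonneg (div_nonneg (Real.log_natCast_nonneg _) (Real.log_nonneg one_le_two))
      n.cast_nonneg
  · gcongr
    exact logb_two_natCast_le _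

theorem tendsto_div_of_tendsto_mul_div {a b : ℕ → ℕ} {C : ℝ} (hb : Tendsto b atTop atTop)
    (hab : Tendsto (fun n => (a n * b n : ℝ) / n) atTop (𝓝 C)) :
    Tendsto (fun n => (a n : ℝ) / n) atTop (𝓝 0) := by
  refine (hab.div_atTop (tendsto_natCast_atTop_atTop.comp hb)).congr' ?_
  filter_upwards [hb.eventually_ne_atTop 0] with n hn
  have : (b n : ℝ) ≠ 0 := Nat.cast_ne_zero.2 hn
  simp only [Function.comp_apply]
  field_simp

theorem logb_logb_kyClass_size {m k : ℕ} (hm : 1 ≤ m) (hk : 1 ≤ k) (t : ℕ) :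
    Real.logb 2 (Real.logb 2 (((2 ^ m) ^ (k * (2 ^ m) ^ t) : ℕ) : ℝ)) =
      Real.logb 2 m + Real.logb 2 k + m * t := by
  have hlog : Real.logb 2 (((2 ^ m) ^ (k * (2 ^ m) ^ t) : ℕ) : ℝ) = m * k * 2 ^ (m * t) := by
    push_cast
    rw [← pow_mul, Real.logb_pow, Real.logb_self_eq_one one_lt_two]
    push_cast
    ring
  rw [hlog, Real.logb_mul (by positivity) (by positivity),
    Real.logb_mul (by positivity) (by positivity), Real.logb_pow,
    Real.logb_self_eq_one one_lt_two, mul_one, Nat.cast_mul]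

theorem tendsto_logb_logb_kyClass_size_div {k m : ℕ → ℕ} {C : ℝ}
    (hkm : ∀ n, 1 ≤ k n ∧ 1 ≤ m n) (hk : Tendsto k atTop atTop) (hm : Tendsto m atTop atTop)
    (hmk : Tendsto (fun n => (m n * k n : ℝ) / n) atTop (𝓝 C)) :
    Tendsto (fun n => Real.logb 2 (Real.logb 2
      (((2 ^ m n) ^ (k n * (2 ^ m n) ^ (k n - 1)) : ℕ) : ℝ)) / n) atTop (𝓝 C) := by
  have hm0 := tendsto_div_of_tendsto_mul_div hk hmk
  have hk0 : Tendsto (fun n => (k n : ℝ) / n) atTop (𝓝 0) :=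
    tendsto_div_of_tendsto_mul_div hm (by simpa only [mul_comm] using hmk)
  have hsum := ((tendsto_logb_two_div hm0).add (tendsto_logb_two_div hk0)).add (hmk.sub hm0)
  rw [add_zero, zero_add, sub_zero] at hsum
  refine hsum.congr fun n => ?_
  rw [logb_logb_kyClass_size (hkm n).2 (hkm n).1, Nat.cast_sub (hkm n).1]
  push_cast
  ring

theorem tendsto_add_one_div_two_pow {k m : ℕ → ℕ} {c : ℝ} (hm : Tendsto m atTop atTop)
    (hkm : ∀ᶠ n in atTop, (k n : ℝ) ≤ c * m n) :
    Tendsto (fun n => (k n + 1 : ℝ) / 2 ^ m n) atTop (𝓝 0) := by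
  have hpow (j : ℕ) := (tendsto_pow_const_div_const_pow_of_one_lt j (one_lt_two (α := ℝ))).comp hm
  have hlim := ((hpow 1).const_mul c).add (hpow 0)
  rw [mul_zero, add_zero] at hlim
  refine squeeze_zero' (.of_forall fun n => by positivity) ?_ hlim
  filter_upwards [hkm] with n hn
  simp only [Function.comp_apply, pow_one, pow_zero]
  rw [← mul_div_assoc, ← add_div]
  gcongr

theorem exists_mul_add_le_and_tendsto_mul_div {k : ℕ → ℕ} {r : ℕ → ℝ} {C : ℝ} (hC : 0 < C)
    (hr : Tendsto r atTop (𝓝 C)) (hk : Tendsto k atTop atTop)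
    (hnk : Tendsto (fun n : ℕ => (n : ℝ) / k n) atTop atTop) (L : ℕ) :
    ∃ m : ℕ → ℕ, (∀ n, 1 ≤ m n) ∧ Tendsto m atTop atTop ∧
      Tendsto (fun n => (m n * k n : ℝ) / n) atTop (𝓝 C) ∧
      ∀ᶠ n : ℕ in atTop, (m n * (k n + L) : ℝ) ≤ n * r n := by
  let u (n : ℕ) : ℝ := r n * (k n / (k n + L))
  let x (n : ℕ) : ℝ := n * r n / (k n + L)
  have hu : Tendsto u atTop (𝓝 C) := by
    simpa using hr.mul ((tendsto_natCast_div_add_atTop (L : ℝ)).comp hk)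
  have hxu : ∀ᶠ n in atTop, n / k n * u n = x n := by
    filter_upwards [hk.eventually_gt_atTop 0] with n hn
    simp only [u, x]
    field_simp
  have hx : Tendsto x atTop atTop := (hnk.atTop_mul_pos hC hu).congr' hxu
  have hfloor : Tendsto (fun n => ⌊x n⌋₊) atTop atTop := tendsto_nat_floor_atTop.comp hx
  have hm : (fun n => max 1 ⌊x n⌋₊) =ᶠ[atTop] fun n => ⌊x n⌋₊ := by
    filter_upwards [hfloor.eventually_ge_atTop 1] with n hn using max_eq_right hn
  refine ⟨fun n => max 1 ⌊x n⌋₊, fun n => le_max_left _ _, hfloor.congr' hm.symm, ?_, ?_⟩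
  · have hlim := (tendsto_nat_floor_div_atTop.comp hx).mul hu
    rw [one_mul] at hlim
    refine hlim.congr' ?_
    filter_upwards [hm, hxu, hx.eventually_gt_atTop 0] with n hmn hxun hxn
    rw [hmn, Function.comp_apply, ← hxun]
    rw [← hxun] at hxn
    have hun : u n ≠ 0 := right_ne_zero_of_mul hxn.ne'
    field_simp
  · filter_upwards [hm, hk.eventually_gt_atTop 0, hx.eventually_ge_atTop 0] with n hmn hkn hxn
    rw [hmn, ← le_div_iff₀ (by positivity)]
    exact Nat.floor_le hxn

theorem tendsto_sqrt_add_one_atTop : Tendsto (fun n : ℕ => n.sqrt + 1) atTop atTop := by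
  refine tendsto_atTop.2 fun b => ?_
  filter_upwards [eventually_ge_atTop (b * b)] with n hn
  exact (Nat.le_sqrt.2 hn).trans (Nat.le_succ _)

theorem sqrt_add_one_sq_le {n : ℕ} (hn : 1 ≤ n) : (n.sqrt + 1) * (n.sqrt + 1) ≤ 4 * n := by
  have hsqrt : 1 ≤ n.sqrt := Nat.le_sqrt.2 hn
  nlinarith [n.sqrt_le, hsqrt]

/-- With `k ≈ √n` and `m ≈ n r / k`, both the overhead `m (K + 2)` of the message over `m k` bits
and `log₂ m + log₂ k` are `o(n)`, while `k` is only linear in `m`. -/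
theorem exists_kyParameters {C : ℝ} (hC : 0 < C) {r : ℕ → ℝ} (hr : Tendsto r atTop (𝓝 C))
    (K : ℕ) : ∃ k m : ℕ → ℕ, (∀ n, 1 ≤ k n ∧ 1 ≤ m n) ∧
      Tendsto (fun n => Real.logb 2 (Real.logb 2
        (((2 ^ m n) ^ (k n * (2 ^ m n) ^ (k n - 1)) : ℕ) : ℝ)) / n) atTop (𝓝 C) ∧
      Tendsto (fun n => (k n + 1 : ℝ) / 2 ^ m n) atTop (𝓝 0) ∧
      ∀ᶠ n : ℕ in atTop, (m n * (k n + (2 + K : ℕ)) : ℝ) ≤ n * r n := by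
  let k (n : ℕ) : ℕ := n.sqrt + 1
  have hk : Tendsto k atTop atTop := tendsto_sqrt_add_one_atTop
  have hkpos (n : ℕ) : (0 : ℝ) < k n := Nat.cast_pos.2 n.sqrt.succ_pos
  have hsq : ∀ᶠ n : ℕ in atTop, (k n * k n : ℝ) ≤ 4 * n := by
    filter_upwards [eventually_ge_atTop 1] with n hn
    exact_mod_cast sqrt_add_one_sq_le hn
  have hnk : Tendsto (fun n : ℕ => (n : ℝ) / k n) atTop atTop := by
    refine tendsto_atTop_mono' _ ?_
      ((tendsto_natCast_atTop_atTop (R := ℝ).comp hk).atTop_div_const four_pos)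
    filter_upwards [hsq] with n hn
    rw [Function.comp_apply, div_le_div_iff₀ four_pos (hkpos n)]
    linarith
  obtain ⟨m, hm1, hm, hmk, hsize⟩ := exists_mul_add_le_and_tendsto_mul_div hC hr hk hnk (2 + K)
  have hkm (n : ℕ) : 1 ≤ k n ∧ 1 ≤ m n := ⟨Nat.le_add_left 1 _, hm1 n⟩
  refine ⟨k, m, hkm, tendsto_logb_logb_kyClass_size_div hkm hk hm hmk,
    tendsto_add_one_div_two_pow (c := 8 / C) hm ?_, hsize⟩
  filter_upwards [hsq, hmk.eventually_const_lt (half_lt_self hC), eventually_gt_atTop 0]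
    with n hn hlt hn0
  rw [lt_div_iff₀ (Nat.cast_pos.2 hn0)] at hlt
  rw [div_mul_eq_mul_div, le_div_iff₀ hC]
  refine le_of_mul_le_mul_right ?_ (hkpos n)
  nlinarith

theorem natCard_message {m : ℕ} (hm : 1 ≤ m) (k K : ℕ) :
    Nat.card (Fin ((2 ^ m) ^ (k + 2)) × (Fin K → GaloisField 2 m)) = 2 ^ (m * (k + (2 + K))) := by
  rw [Nat.card_prod, Nat.card_fun, Nat.card_fin, Nat.card_fin, natCard_galoisField_two hm,
    ← pow_add, ← pow_mul, add_assoc]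

theorem IsKYClass.isAU {m k : ℕ} (hk : 1 ≤ k)
    {h : Fin ((2 ^ m) ^ (k + 2)) → Fin ((2 ^ m) ^ (k * (2 ^ m) ^ (k - 1))) → GaloisField 2 m}
    (hh : IsKYClass m k (k - 1) h) : IsAU ((k + 1) / 2 ^ m) h := by
  have hε : (k : ℝ) / 2 ^ m + (((2 : ℝ) ^ m) ^ (k - 1) - 1) / ((2 : ℝ) ^ m) ^ k ≤
      (k + 1) / 2 ^ m := by
    rw [add_div]
    refine add_le_add_right ?_ _
    rw [div_le_div_iff₀ (by positivity) (by positivity), sub_mul, ← pow_succ,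
      Nat.sub_add_cancel hk, one_mul, one_mul]
    exact sub_le_self _ (by positivity)
  exact fun a₁ a₂ ha => (IsASU.isAU hh a₁ a₂ ha).trans
    (mul_le_mul_of_nonneg_right hε (Nat.cast_nonneg _))

end Parameters

theorem corollary1 {X Y : Type*} [Fintype X] [Fintype Y] (W : DMC X Y) (hC : 0 < W.capacity)
    (K : ℕ) (hK : 1 ≤ K) :
    -- parameters of the hash classes, for every code length `n`
    ∃ k m : ℕ → ℕ, (∀ n, 1 ≤ k n ∧ 1 ≤ m n) ∧
      -- such hash classes exist
      (∀ n, ∃ h, IsKYClass (m n) (k n) (k n - 1) h) ∧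
      -- transmission codes of length `n` for the channel
      ∃ (f : ∀ n, Fin ((2 ^ m n) ^ (k n + 2)) × (Fin K → GaloisField 2 (m n)) → (Fin n → X))
        (g : ∀ n, (Fin n → Y) → Fin ((2 ^ m n) ^ (k n + 2)) × (Fin K → GaloisField 2 (m n))),
        -- whichever hash classes with these parameters are used
        ∀ h : ∀ n, Fin ((2 ^ m n) ^ (k n + 2)) →
            Fin ((2 ^ m n) ^ (k n * (2 ^ m n) ^ (k n - 1))) → GaloisField 2 (m n),
          (∀ n, IsKYClass (m n) (k n) (k n - 1) (h n)) →
            Tendsto (fun n => (codingScheme1 (h n) (f n) (g n)).rate) atTop (𝓝 W.capacity) ∧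
            Tendsto (fun n => (codingScheme1 (h n) (f n) (g n)).typeIError W) atTop (𝓝 0) ∧
            Tendsto (fun n => (codingScheme1 (h n) (f n) (g n)).typeIIError W) atTop (𝓝 0) := by
  have := DMC.nonempty_of_capacity_ne_zero hC.ne'
  obtain ⟨d, hd0, hd, hcode⟩ := W.exists_tendsto_zero_eventually_exists_maxErrorLE
  obtain ⟨k, m, hkm, hrate, heps, hsize⟩ := exists_kyParameters hC
    (r := fun n => W.capacity - d n) (by simpa using hd.const_sub W.capacity) K
  let A (n : ℕ) : Type := Fin ((2 ^ m n) ^ (k n + 2)) × (Fin K → GaloisField 2 (m n))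
  have hcodes : ∀ᶠ n in atTop, ∃ fg : (A n → Fin n → X) × ((Fin n → Y) → A n),
      (W.block n).MaxErrorLE fg.1 fg.2 (d n) := by
    filter_upwards [hcode, hsize] with n hn hsn
    obtain ⟨f, g, hfg⟩ := hn (A n) (by
      rw [natCard_message (hkm n).2, Nat.cast_pow, Nat.cast_two, ← Real.rpow_natCast]
      exact Real.rpow_le_rpow_of_exponent_le one_le_two (by exact_mod_cast hsn))
    exact ⟨(f, g), hfg⟩
  obtain ⟨fg, hfg⟩ := Filter.skolem.1 hcodes
  refine ⟨k, m, hkm, fun n => exists_isKYClass (hkm n).2 (hkm n).1 _, fun n => (fg n).1,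
    fun n => (fg n).2, fun h hh => ⟨hrate, ?_, ?_⟩⟩
  · refine squeeze_zero' (.of_forall fun n => MOIDCode.typeIError_nonneg _ W) ?_ hd
    filter_upwards [hfg] with n hn using typeIError_codingScheme1_le (hd0 n) hn
  · have hlim : Tendsto (fun n => d n + K * ((k n + 1) / 2 ^ m n)) atTop (𝓝 0) := by
      simpa using hd.add (heps.const_mul (K : ℝ))
    refine squeeze_zero' (.of_forall fun n => MOIDCode.typeIIError_nonneg _ W) ?_ hlim
    filter_upwards [hfg] with n hn using typeIIError_codingScheme1_le (hd0 n) (by positivity)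
      ((hh n).isAU (hkm n).1) hn
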